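/- Let $AP$ be a finite non-empty set of atomic propositions. A Markov chain $D$ has a countable state set $S$, a transition distribution $\mu_s$ on $S$ for every $s\in S$, a labelling $L:S\to 2^{AP}$ and an initial state $s_0$; $\Pr_s$ denotes the probability measure on infinite paths started in $s$. PCTL state formulas $\Phi$ and path formulas $\varphi$ are given by $$\Phi ::= a\mid \Phi\wedge\Phi\mid\Phi\vee\Phi\mid\neg\Phi\mid \mathbb P_{\bowtie q}(\varphi),\qquad \varphi::= \mathsf X\,\Phi\mid \Phi\,\mathsf U\,\Phi\mid\Phi\,\mathsf W\,\Phi,$$ with $a\in AP$, $\bowtie\in\{<,>,\le,\ge\}$, $q\in[0,1]$. They have the standard semantics: $s\models\mathbb P_{\bowtie q}(\varphi)$ iff $\Pr_s(\{\pi:\pi\models\varphi\})\bowtie q$, and $\pi\models\Phi_1\mathsf W\Phi_2$ iff $\pi\models\Phi_1\mathsf U\Phi_2$ or all states of $\pi$ satisfy $\Phi_1$. Write $\top=a\vee\neg a$, $\bot=\neg\top$, $\Diamond\Phi=\top\,\mathsf U\,\Phi$, and $D\models\Phi$ iff $s_0\models\Phi$. A probabilistic tree $T=(W,L,P)$ consists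 of a set $W$ of non-empty finite sequences over $\mathbb N$ that is closed under non-empty prefixes and contains exactly one sequence of length $1$ (the root), a labelling $L:W\to 2^{AP}$, and a partial function $P$ from $W$ to the distributions on $W$ such that $P(\pi)(\pi')>0$ iff $\pi'\in W$ extends $\pi$ by exactly one letter; $P(\pi)(\pi')$ is read as $0$ if $P(\pi)$ is undefined, that is, if $\pi$ is a leaf. $T$ is total if every node has a proper extension in $W$, and of finite depth if the lengths of its nodes are bounded. A finite-depth tree $T_1$ is a prefix of $T_2$, written $T_1\preceq T_2$, if $W_1\subseteq W_2$, $L_2$ restricts to $L_1$ on $W_1$, and $P_2$ restricts to $P_1$ on $W_1\times W_1$. The unfolding $T(D)$ of a Markov chain $D$ is the total tree whose nodes are the finite state sequences that start in $s_0$ and follow transitions of positive probability, a node with last state $s$ having label $L(s)$ and its edge to the extension by $t$ having probability $\mu_s(t)$. The property of $\Phi$ is the set $P_\Phi$ of all total trees that coincide, up to renaming of nodes, with $T(D)$ for some Markov chain $D\models\Phi$. We write $\Phi\not\equiv\bot$ if $P_\Phi\neq\emptyset$. A set $P$ of total trees is a liveness property if for every finite-depth tree $T_1$ there is $T_2\in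 P$ with $T_1\preceq T_2$. For a set $B$ of comparison operators, let $\mathcal F_B$ be the smallest set of state formulas such that 1. $\top\in\mathcal F_B$; 2. $\mathbb P_{\rhd q}(\Diamond\Phi^a)\in\mathcal F_B$ for every Boolean combination $\Phi^a$ of atomic propositions; 3. if $\Phi_1,\Phi_2\in\mathcal F_B$, then $\Phi_1\wedge\Phi_2\in\mathcal F_B$; 4. if $\Phi_1\in\mathcal F_B$ or $\Phi_2\in\mathcal F_B$, then $\Phi_1\vee\Phi_2\in\mathcal F_B$ and $\mathbb P_{\rhd q}(\Phi_1\mathsf W\Phi_2)\in\mathcal F_B$; 5. if $\Phi\in\mathcal F_B$, then $\mathbb P_{\rhd q}(\mathsf X\,\Phi)\in\mathcal F_B$; 6. if $\Phi_2\in\mathcal F_B$, then $\mathbb P_{\rhd q}(\Phi_1\mathsf U\Phi_2)\in\mathcal F_B$ for every state formula $\Phi_1$; for all $\rhd\in B$ and $q\in[0,1]$, where in clauses 2, 4, 5, 6 a formula $\mathbb P_{\rhd q}(\varphi)$ is admitted only if $\mathbb P_{\rhd q}(\varphi)\not\equiv\bot$. Let $\mathrm{PCTL}_{live}^{<}=\mathcal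 F_{\{\ge\}}$. **Theorem.** For every formula $\Phi$ of $\mathrm{PCTL}_{live}^{<}$, $P_\Phi$ is a liveness property. The same holds for every $\Phi\in\mathcal F_{\{\ge,>\}}$, the extension of the fragment by strict bounds. -/

import Mathlib

namespace PCTL

universe u

open MeasureTheory ProbabilityTheory

/-- Discrete-time Markov chains with state labels in the subsets of `AP`. -/
structure MarkovChain (AP : Type*) where
  State : Type
  countable_state : Countable State
  trans : State → PMF State
  label : State → Set AP
  init : State

namespace MarkovChain

variable {AP : Type*} (D : MarkovChain AP)

instance : Countable D.State := D.countable_state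

/-- The state space carries the discrete sigma-algebra, so that the product sigma-algebra on
`ℕ → D.State` is the one generated by the cylinder sets of finite state sequences. -/
instance : MeasurableSpace D.State := ⊤

instance : DiscreteMeasurableSpace D.State := ⟨fun _ => trivial⟩

/-- The transition kernel at time `n`: it only looks at the last state of the history. -/
noncomputable def stepKernel (n : ℕ) :
    Kernel ((i : Finset.Iic n) → (fun _ : ℕ => D.State) i) D.State where
  toFun h := (D.trans (h ⟨n, Finset.mem_Iic.2 le_rfl⟩)).toMeasure
  measurable' := Measurable.of_discrete

instance (n : ℕ) : IsMarkovKernel (D.stepKernel n) :=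
  ⟨fun _ => PMF.toMeasure.isProbabilityMeasure _⟩

/-- The probability measure on infinite paths of the chain started in `s`
(Ionescu-Tulcea construction). -/
noncomputable def pathMeasure (s : D.State) : Measure (ℕ → D.State) :=
  Kernel.traj (X := fun _ => D.State) D.stepKernel 0 (fun _ => s)

open Preorder in
theorem partialTraj_stepKernel_singleton (s : D.State) (σ : ℕ → D.State) (h0 : σ 0 = s) (n : ℕ) :
    Kernel.partialTraj (X := fun _ => D.State) D.stepKernel 0 n (fun _ => s) {frestrictLe n σ}
      = ∏ i ∈ Finset.range n, D.trans (σ i) (σ (i+1)) := by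
  induction n with
  | zero =>
    have : (fun _ => s : (i : Finset.Iic 0) → D.State) = frestrictLe 0 σ := by
      ext ⟨i, hi⟩
      simp at hi
      subst hi
      simp [h0]
    rw [Kernel.partialTraj_self, Kernel.id_apply, this]
    simp
  | succ n ih =>
    rw [Finset.prod_range_succ, ← ih, Kernel.partialTraj_succ_of_le (Nat.zero_le n),
      Kernel.map_apply' _ (by fun_prop) _ (measurableSet_singleton _),
      Kernel.comp_apply' _ _ _ (.of_discrete)]
    have key : ∀ h : ((i : Finset.Iic n) → D.State),
        ((Kernel.id ×ₖ ((D.stepKernel n).map (MeasurableEquiv.piSingleton (X := fun _ => D.State) n))) h)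
          (IicProdIoc (X := fun _ => D.State) n (n+1) ⁻¹' {frestrictLe (n+1) σ})
        = ({frestrictLe n σ} : Set ((i : Finset.Iic n) → D.State)).indicator (fun _ => D.trans (σ n) (σ (n+1))) h := by
      intro h
      have : (IicProdIoc (X := fun _ => D.State) n (n+1) ⁻¹' {frestrictLe (n+1) σ}) =
         ({frestrictLe n σ} : Set ((i : Finset.Iic n) → D.State)) ×ˢ {MeasurableEquiv.piSingleton (X := fun _ => D.State) n (σ (n+1))} := by
        ext ⟨a, b⟩
        simp only [Set.mem_preimage, Set.mem_singleton_iff, Set.mem_prod]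
        constructor
        · intro hh
          constructor
          · ext ⟨i, hi⟩
            have := congrFun hh ⟨i, by simp at hi ⊢; omega⟩
            simp at hi
            simpa [IicProdIoc, hi] using this
          · ext ⟨i, hi⟩
            simp at hi
            have : i = n+1 := by omega
            subst this
            have := congrFun hh ⟨n+1, by simp⟩
            simpa [IicProdIoc, MeasurableEquiv.piSingleton] using this
        · rintro ⟨rfl, rfl⟩
          ext ⟨i, hi⟩
          simp at hi
          by_cases h : i ≤ n
          · simp [IicProdIoc, h]
          · have : i = n+1 := by omega
            subst this
            simp [IicProdIoc, MeasurableEquiv.piSingleton]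
      rw [this]
      have : IsMarkovKernel ((D.stepKernel n).map (MeasurableEquiv.piSingleton (X := fun _ => D.State) n)) := Kernel.IsMarkovKernel.map _ (by fun_prop)
      rw [Kernel.prod_apply, Measure.prod_prod, Kernel.id_apply, Measure.dirac_apply' _ (measurableSet_singleton _), Kernel.map_apply' _ (by fun_prop) _ (measurableSet_singleton _)]
      have h2 : (MeasurableEquiv.piSingleton (X := fun _ => D.State) n) ⁻¹' {MeasurableEquiv.piSingleton (X := fun _ => D.State) n (σ (n+1))} = {σ (n+1)} := by
        ext; simp
      rw [h2]
      by_cases hh : h = frestrictLe n σ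
      · subst hh
        simp only [Set.mem_singleton_iff, Set.indicator_of_mem, Pi.one_apply, one_mul]
        exact PMF.toMeasure_apply_singleton _ _ (measurableSet_singleton _)
      · simp [hh]
    refine (lintegral_congr key).trans ?_
    rw [lintegral_indicator (measurableSet_singleton _)]
    simp [mul_comm]

open Preorder in
/-- The measure of a cylinder set is the product of the transition probabilities. -/
theorem pathMeasure_cylinder (s : D.State) (σ : ℕ → D.State) (h0 : σ 0 = s) (n : ℕ) :
    D.pathMeasure s {p | ∀ i ≤ n, p i = σ i}
      = ∏ i ∈ Finset.range n, D.trans (σ i) (σ (i+1)) := by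
  rw [← partialTraj_stepKernel_singleton D s σ h0, ← Kernel.traj_map_frestrictLe_apply, Measure.map_apply (by fun_prop) (measurableSet_singleton _)]
  congr 1
  ext p
  simp [funext_iff]
end MarkovChain

/-- Comparison operators on the reals. -/
inductive Cmp
  | lt | gt | le | ge

def Cmp.holds : Cmp → ℝ → ℝ → Prop
  | .lt, x, y => x < y
  | .gt, x, y => x > y
  | .le, x, y => x ≤ y
  | .ge, x, y => x ≥ y

mutual
  /-- State formulas. Disjunction is included, so that formulas in positive normal form are
  literally formulas. -/
  inductive StateFormula (AP : Type u)
    | atom (a : AP)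
    | and (Φ₁ Φ₂ : StateFormula AP)
    | or (Φ₁ Φ₂ : StateFormula AP)
    | not (Φ : StateFormula AP)
    | prob (c : Cmp) (q : unitInterval) (φ : PathFormula AP)
  /-- Path formulas. -/
  inductive PathFormula (AP : Type u)
    | next (Φ : StateFormula AP)
    | until (Φ₁ Φ₂ : StateFormula AP)
    | weakUntil (Φ₁ Φ₂ : StateFormula AP)
end

mutual
  /-- Satisfaction of a state formula in a state. -/
  def StateFormula.Sat {AP : Type*} (D : MarkovChain AP) : StateFormula AP → D.State → Prop
    | .atom a, s => a ∈ D.label s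
    | .and Φ₁ Φ₂, s => Φ₁.Sat D s ∧ Φ₂.Sat D s
    | .or Φ₁ Φ₂, s => Φ₁.Sat D s ∨ Φ₂.Sat D s
    | .not Φ, s => ¬ Φ.Sat D s
    | .prob c q φ, s => c.holds ((D.pathMeasure s).real {p | p 0 = s ∧ φ.Sat D p}) q
  /-- Satisfaction of a path formula by an infinite path. -/
  def PathFormula.Sat {AP : Type*} (D : MarkovChain AP) : PathFormula AP → (ℕ → D.State) → Prop
    | .next Φ, p => Φ.Sat D (p 1)
    | .until Φ₁ Φ₂, p => ∃ j, Φ₂.Sat D (p j) ∧ ∀ k < j, Φ₁.Sat D (p k)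
    | .weakUntil Φ₁ Φ₂, p =>
        (∃ j, Φ₂.Sat D (p j) ∧ ∀ k < j, Φ₁.Sat D (p k)) ∨ ∀ i, Φ₁.Sat D (p i)
end

/-- `⊤`, written as `a ∨ ¬a`. -/
def StateFormula.top {AP : Type*} (a : AP) : StateFormula AP :=
  .or (.atom a) (.not (.atom a))

/-- `D ⊨ Φ`. -/
def MarkovChain.Models {AP : Type*} (D : MarkovChain AP) (Φ : StateFormula AP) : Prop :=
  Φ.Sat D D.init

/-- Probabilistic trees whose nodes are nonempty sequences over `ι`, with a unique root (node of
length one). The partial edge labelling `edge` is undefined exactly at the leaves. -/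
structure ProbTree (ι AP : Type*) where
  nodes : Set (List ι)
  nil_notMem : [] ∉ nodes
  prefix_closed : ∀ π ∈ nodes, ∀ π', π' <+: π → π' ≠ [] → π' ∈ nodes
  exists_unique_root : ∃! i, [i] ∈ nodes
  label : nodes → Set AP
  edge : nodes → Option (PMF nodes)
  edge_pos : ∀ π π' : nodes, (∃ μ, edge π = some μ ∧ 0 < μ π') ↔ ∃ i, π'.1 = π.1 ++ [i]

namespace ProbTree

variable {ι κ AP : Type*}

/-- The number `P(π, π')`, which is `0` if `P(π)` is undefined. -/
noncomputable def prob (T : ProbTree ι AP) (π π' : T.nodes) : ENNReal :=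
  (T.edge π).elim 0 (fun μ => μ π')

def IsTotal (T : ProbTree ι AP) : Prop :=
  ∀ π ∈ T.nodes, ∃ π' ∈ T.nodes, π <+: π' ∧ π ≠ π'

def IsFiniteDepth (T : ProbTree ι AP) : Prop :=
  ∃ n : ℕ, ∀ π ∈ T.nodes, π.length ≤ n

/-- `T₁` is a prefix of `T₂`. -/
def IsPrefix (T₁ T₂ : ProbTree ι AP) : Prop :=
  ∃ h : T₁.nodes ⊆ T₂.nodes,
    (∀ π : T₁.nodes, T₂.label (Set.inclusion h π) = T₁.label π) ∧
    ∀ π π' : T₁.nodes,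
      T₂.prob (Set.inclusion h π) (Set.inclusion h π') = T₁.prob π π'

/-- Equality of probabilistic trees up to renaming of nodes. Edges are the pairs of positive
probability, so they are preserved, and with them the root and the prefix order. -/
def Iso (T : ProbTree ι AP) (T' : ProbTree κ AP) : Prop :=
  ∃ e : T.nodes ≃ T'.nodes,
    (∀ π, T'.label (e π) = T.label π) ∧ ∀ π π', T'.prob (e π) (e π') = T.prob π π'

end ProbTree

namespace MarkovChain

variable {AP : Type*} (D : MarkovChain AP)

/-- The nodes of the unfolding; `History π s` says that `π` is a node with last state `s`. -/
inductive History : List D.State → D.State → Prop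
  | init : History [D.init] D.init
  | step {π : List D.State} {s t : D.State} :
      History π s → t ∈ (D.trans s).support → History (π ++ [t]) t

variable {D}

theorem History.ne_nil {π : List D.State} {s : D.State} (h : D.History π s) : π ≠ [] := by
  cases h <;> simp

theorem History.getLast?_eq {π : List D.State} {s : D.State} (h : D.History π s) :
    π.getLast? = some s := by
  cases h <;> simp

theorem History.of_append {π : List D.State} {s t : D.State} (h : D.History (π ++ [t]) s)
    (hπ : π ≠ []) : ∃ r, D.History π r ∧ t ∈ (D.trans r).support := by
  generalize hl : π ++ [t] = l at h
  cases h with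
  | init =>
    have := congrArg List.length hl
    simp at this
    exact absurd this hπ
  | step h' ht =>
    obtain ⟨rfl, h2⟩ := List.append_inj' hl rfl
    simp only [List.cons.injEq, and_true] at h2
    subst h2
    exact ⟨_, h', ht⟩

theorem History.of_prefix {π : List D.State} {s : D.State} (h : D.History π s) :
    ∀ π', π' <+: π → π' ≠ [] → ∃ r, D.History π' r := by
  induction h with
  | init =>
    intro π' h1 h2
    rcases List.prefix_cons_iff.1 h1 with h | ⟨l, rfl, h⟩
    · exact absurd h h2
    · rw [List.prefix_nil] at h
      subst h
      exact ⟨_, History.init⟩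
  | step h' ht ih =>
    intro π' h1 h2
    rcases List.prefix_concat_iff.1 h1 with rfl | h
    · exact ⟨_, History.step h' ht⟩
    · exact ih π' h h2

variable (D)

/-- The last state of a node of the unfolding. -/
def lastState (π : {π : List D.State | ∃ s, D.History π s}) : D.State :=
  π.1.getLast (by obtain ⟨s, h⟩ := π.2; exact h.ne_nil)

theorem history_lastState (π : {π : List D.State | ∃ s, D.History π s}) :
    D.History π.1 (D.lastState π) := by
  obtain ⟨π, s, h⟩ := π
  have h1 := h.getLast?_eq
  rw [List.getLast?_eq_some_getLast h.ne_nil] at h1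
  have h2 : D.lastState ⟨π, s, h⟩ = s := Option.some.inj h1
  rw [h2]
  exact h

/-- The unfolding `T(D)`: the edge distribution at `π` moves to `π ++ [t]` with probability
`D.trans (last state of π) t`. -/
noncomputable def unfolding : ProbTree D.State AP where
  nodes := {π | ∃ s, D.History π s}
  nil_notMem := fun ⟨_, h⟩ => h.ne_nil rfl
  prefix_closed := fun _ ⟨_, h⟩ => h.of_prefix
  exists_unique_root := by
    refine ⟨D.init, ⟨_, History.init⟩, ?_⟩
    rintro i ⟨s, h⟩
    generalize hl : [i] = l at h
    cases h with
    | init => simpa using hl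
    | step h' _ =>
      have h1 := congrArg List.length hl
      have h2 := List.length_pos_iff.2 h'.ne_nil
      simp at h1
      exact absurd h1 h'.ne_nil
  label π := D.label (D.lastState π)
  edge π := some ((D.trans (D.lastState π)).bindOnSupport fun t ht =>
    PMF.pure ⟨π.1 ++ [t], t, (D.history_lastState π).step ht⟩)
  edge_pos π π' := by
    simp only [Option.some.injEq, exists_eq_left', pos_iff_ne_zero]
    rw [← PMF.mem_support_iff, PMF.mem_support_bindOnSupport_iff]
    constructor
    · rintro ⟨t, ht, h⟩
      rw [PMF.mem_support_pure_iff] at h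
      exact ⟨t, congrArg Subtype.val h⟩
    · rintro ⟨t, h⟩
      obtain ⟨s, hs⟩ := π'.2
      rw [h] at hs
      obtain ⟨r, hr, ht⟩ := hs.of_append (D.history_lastState π).ne_nil
      have h1 := hr.getLast?_eq
      rw [(D.history_lastState π).getLast?_eq] at h1
      obtain rfl := Option.some.inj h1
      refine ⟨t, ht, ?_⟩
      rw [PMF.mem_support_pure_iff]
      exact Subtype.ext h

end MarkovChain

/-- The property of a formula: the trees over `ℕ` that are, up to renaming of nodes, unfoldings of
Markov chains satisfying the formula. -/
def property {AP : Type*} (Φ : StateFormula AP) : Set (ProbTree ℕ AP) :=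
  {T | T.IsTotal ∧ ∃ D : MarkovChain AP, D.Models Φ ∧ D.unfolding.Iso T}

/-- Liveness of a set of total probabilistic trees. -/
def IsLiveness {AP : Type*} (P : Set (ProbTree ℕ AP)) : Prop :=
  (∀ T ∈ P, T.IsTotal) ∧
    ∀ T₁ : ProbTree ℕ AP, T₁.IsFiniteDepth → ∃ T₂ ∈ P, T₁.IsPrefix T₂

/-- `Φ ≢ ⊥`. -/
def Satisfiable {AP : Type*} (Φ : StateFormula AP) : Prop := (property Φ).Nonempty

/-- Literal formulas: Boolean combinations of atomic propositions. -/
inductive IsLiteral {AP : Type*} : StateFormula AP → Prop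
  | atom (a : AP) : IsLiteral (.atom a)
  | not {Φ : StateFormula AP} : IsLiteral Φ → IsLiteral (.not Φ)
  | and {Φ₁ Φ₂ : StateFormula AP} : IsLiteral Φ₁ → IsLiteral Φ₂ → IsLiteral (.and Φ₁ Φ₂)
  | or {Φ₁ Φ₂ : StateFormula AP} : IsLiteral Φ₁ → IsLiteral Φ₂ → IsLiteral (.or Φ₁ Φ₂)

/-- The live fragment whose probabilistic operators use comparisons from `B`. Formulas equivalent
to `⊥` are kept out of the fragment. Only the probabilistic clauses need this proviso:
`⊤`, conjunctions and disjunctions are subject to none. -/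
inductive LiveFragment {AP : Type*} (B : Set Cmp) : StateFormula AP → Prop
  | top (a : AP) : LiveFragment B (.top a)
  | eventually {c : Cmp} (hc : c ∈ B) (q : unitInterval) (a : AP) {Φ : StateFormula AP} :
      IsLiteral Φ → Satisfiable (.prob c q (.until (.top a) Φ)) →
      LiveFragment B (.prob c q (.until (.top a) Φ))
  | and {Φ₁ Φ₂ : StateFormula AP} :
      LiveFragment B Φ₁ → LiveFragment B Φ₂ → LiveFragment B (.and Φ₁ Φ₂)
  | or_left {Φ₁ : StateFormula AP} (Φ₂ : StateFormula AP) :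
      LiveFragment B Φ₁ → LiveFragment B (.or Φ₁ Φ₂)
  | or_right (Φ₁ : StateFormula AP) {Φ₂ : StateFormula AP} :
      LiveFragment B Φ₂ → LiveFragment B (.or Φ₁ Φ₂)
  | weakUntil_left {c : Cmp} (hc : c ∈ B) (q : unitInterval) {Φ₁ : StateFormula AP}
      (Φ₂ : StateFormula AP) :
      LiveFragment B Φ₁ → Satisfiable (.prob c q (.weakUntil Φ₁ Φ₂)) →
      LiveFragment B (.prob c q (.weakUntil Φ₁ Φ₂))
  | weakUntil_right {c : Cmp} (hc : c ∈ B) (q : unitInterval) (Φ₁ : StateFormula AP)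
      {Φ₂ : StateFormula AP} :
      LiveFragment B Φ₂ → Satisfiable (.prob c q (.weakUntil Φ₁ Φ₂)) →
      LiveFragment B (.prob c q (.weakUntil Φ₁ Φ₂))
  | next {c : Cmp} (hc : c ∈ B) (q : unitInterval) {Φ : StateFormula AP} :
      LiveFragment B Φ → Satisfiable (.prob c q (.next Φ)) →
      LiveFragment B (.prob c q (.next Φ))
  | until {c : Cmp} (hc : c ∈ B) (q : unitInterval) (Φ₁ : StateFormula AP)
      {Φ₂ : StateFormula AP} :
      LiveFragment B Φ₂ → Satisfiable (.prob c q (.until Φ₁ Φ₂)) →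
      LiveFragment B (.prob c q (.until Φ₁ Φ₂))

end PCTL

namespace PCTL

open MeasureTheory ProbabilityTheory

-- Almost every path takes only steps of positive probability.

namespace MarkovChain

variable {AP : Type*} (D : MarkovChain AP)

-- A finite-depth tree is completed by hanging one infinite branch, taken with probability one,
-- below each leaf. New nodes at depth `m` are labelled `f m`, where `f` takes every set of atomic
-- propositions as a value infinitely often. In the chain on the nodes of this tree every positive
-- path then meets every label (`visitsAllLabels_prolong`), and the unfolding of that chain is the
-- tree itself (`unfolding_toMarkovChain_iso`).
--
-- In such a chain every formula of the fragment holds at every state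
-- (`LiveFragment.sat_of_visitsAllLabels`). By induction each path formula holds on all positive
-- paths, hence with probability 1, which meets any bound `≥ q`, and any bound `> q` with `q < 1`;
-- satisfiability excludes `> 1`. The one other use of satisfiability is `◇Φ` with `Φ` Boolean:
-- either some label makes `Φ` true, and that label is visited, or the bound is the trivial `≥ 0`.

instance (s : D.State) : IsProbabilityMeasure (D.pathMeasure s) := by
  unfold pathMeasure
  infer_instance

/-- A path all of whose steps have positive probability. -/
def IsPositivePath (p : ℕ → D.State) : Prop :=
  ∀ n, p (n + 1) ∈ (D.trans (p n)).support

theorem ae_apply_zero (s : D.State) : ∀ᵐ p ∂D.pathMeasure s, p 0 = s := by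
  have h := D.pathMeasure_cylinder s (fun _ => s) rfl 0
  have hm : MeasurableSet {p : ℕ → D.State | p 0 = s} :=
    measurable_pi_apply (X := fun _ : ℕ => D.State) 0 (measurableSet_singleton s)
  exact (mem_ae_iff_prob_eq_one hm).2 (by simpa using h)

theorem ae_mem_support (s : D.State) (n : ℕ) :
    ∀ᵐ p ∂D.pathMeasure s, p (n + 1) ∈ (D.trans (p n)).support := by
  -- There are countably many initial segments of length `n + 2`. One that ends in a step of
  -- probability zero spans a null cylinder, because that step is a factor of its measure.
  have key : ∀ h : Fin (n + 2) → D.State, ∀ᵐ p ∂D.pathMeasure s,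
      (∀ i : Fin (n + 2), p i = h i) → p 0 = s → p (n + 1) ∈ (D.trans (p n)).support := by
    intro h
    let σ : ℕ → D.State := fun i => if hi : i < n + 2 then h ⟨i, hi⟩ else s
    by_cases hσ : σ 0 = s ∧ σ (n + 1) ∉ (D.trans (σ n)).support
    · have hc := D.pathMeasure_cylinder s σ hσ.1 (n + 1)
      rw [Finset.prod_range_succ, (PMF.apply_eq_zero_iff _ _).2 hσ.2, mul_zero] at hc
      filter_upwards [measure_eq_zero_iff_ae_notMem.1 hc] with p hp h1
      refine absurd ?_ hp
      intro i hi
      simpa [σ, Nat.lt_succ_of_le hi] using h1 ⟨i, by omega⟩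
    · refine ae_of_all _ fun p h1 h0 => ?_
      have h2 : ∀ i, i < n + 2 → p i = σ i := fun i hi => by
        simpa [σ, hi] using h1 ⟨i, hi⟩
      rw [h2 _ (by omega), h2 _ (by omega)]
      rw [h2 _ (by omega)] at h0
      by_contra hn
      exact hσ ⟨h0, hn⟩
  filter_upwards [ae_all_iff.2 key, D.ae_apply_zero s] with p hp h0
  exact hp (fun i => p i) (fun _ => rfl) h0

theorem ae_isPositivePath (s : D.State) :
    ∀ᵐ p ∂D.pathMeasure s, p 0 = s ∧ D.IsPositivePath p :=
  (D.ae_apply_zero s).and (ae_all_iff.2 (D.ae_mem_support s))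

-- `A` need not be measurable: the set agrees almost everywhere with the whole space.
variable {D} in
theorem real_pathMeasure_eq_one {s : D.State} {A : (ℕ → D.State) → Prop}
    (h : ∀ p, p 0 = s → D.IsPositivePath p → A p) :
    (D.pathMeasure s).real {p | p 0 = s ∧ A p} = 1 := by
  have h1 : D.pathMeasure s {p | p 0 = s ∧ A p} = 1 := by
    rw [← measure_univ (μ := D.pathMeasure s)]
    refine measure_congr (Filter.eventuallyEq_univ.2 ?_)
    filter_upwards [D.ae_isPositivePath s] with p hp
    exact ⟨hp.1, h p hp.1 hp.2⟩
  simp [Measure.real, h1]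

/-- Every path of positive steps visits every set of atomic propositions as a label. -/
def VisitsAllLabels : Prop :=
  ∀ p : ℕ → D.State, D.IsPositivePath p → ∀ A : Set AP, ∃ j, D.label (p j) = A

end MarkovChain

-- Satisfaction of the live fragment in chains that visit all labels.

variable {AP : Type*}

theorem IsLiteral.sat_iff_of_label_eq {Φ : StateFormula AP} (h : IsLiteral Φ)
    {D D' : MarkovChain AP} {s : D.State} {s' : D'.State} (hs : D.label s = D'.label s') :
    Φ.Sat D s ↔ Φ.Sat D' s' := by
  induction h with
  | atom a => simp only [StateFormula.Sat, hs]
  | not _ ih => simp only [StateFormula.Sat, ih]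
  | and _ _ ih₁ ih₂ => simp only [StateFormula.Sat, ih₁, ih₂]
  | or _ _ ih₁ ih₂ => simp only [StateFormula.Sat, ih₁, ih₂]

theorem StateFormula.sat_top (a : AP) (D : MarkovChain AP) (s : D.State) :
    (StateFormula.top a).Sat D s := by
  simp only [StateFormula.top, StateFormula.Sat]
  exact em _

/-- A satisfiable lower bound on the probability of `φ` holds wherever `φ` holds on every path of
positive steps. -/
theorem Satisfiable.sat_prob {c : Cmp} (hc : c = .ge ∨ c = .gt) {q : unitInterval}
    {φ : PathFormula AP} (hsat : Satisfiable (.prob c q φ)) {D : MarkovChain AP} {s : D.State}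
    (h : ∀ p, p 0 = s → D.IsPositivePath p → φ.Sat D p) :
    (StateFormula.prob c q φ).Sat D s := by
  rw [StateFormula.Sat, MarkovChain.real_pathMeasure_eq_one h]
  rcases hc with rfl | rfl
  · exact q.2.2
  -- A strict bound met by some chain has `q` below a probability, hence `q < 1`.
  · obtain ⟨_, _, D', hD', _⟩ := hsat
    rw [MarkovChain.Models, StateFormula.Sat] at hD'
    exact lt_of_lt_of_le hD' measureReal_le_one

/-- A satisfiable lower bound on the probability of `φ` is trivial, or some path of some chain
satisfies `φ`. -/
theorem Satisfiable.trivial_or_exists_sat {c : Cmp} (hc : c = .ge ∨ c = .gt) {q : unitInterval}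
    {φ : PathFormula AP} (hsat : Satisfiable (.prob c q φ)) :
    (∀ (D : MarkovChain AP) (s : D.State), (StateFormula.prob c q φ).Sat D s) ∨
      ∃ (D : MarkovChain AP) (p : ℕ → D.State), φ.Sat D p := by
  obtain ⟨_, _, D, hD, _⟩ := hsat
  rw [MarkovChain.Models, StateFormula.Sat] at hD
  by_cases hne : {p | p 0 = D.init ∧ φ.Sat D p}.Nonempty
  · obtain ⟨p, hp⟩ := hne
    exact .inr ⟨D, p, hp.2⟩
  -- Now `hD` reads `0 ≥ q` or `0 > q`; the latter is impossible.
  · rw [Set.not_nonempty_iff_eq_empty.1 hne, measureReal_empty] at hD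
    left
    intro D' s
    rw [StateFormula.Sat]
    rcases hc with rfl | rfl
    · exact le_trans hD measureReal_nonneg
    · exact absurd hD (not_lt.2 q.2.1)

/-- The induction runs over all states at once because subformulas are evaluated along paths.
Operands outside the fragment are never evaluated: an until is fulfilled at position 0, a weak until
there or by its left operand holding forever. -/
theorem LiveFragment.sat_of_visitsAllLabels {B : Set Cmp} (hB : ∀ c ∈ B, c = .ge ∨ c = .gt)
    {Φ : StateFormula AP} (hΦ : LiveFragment B Φ) {D : MarkovChain AP}
    (hD : D.VisitsAllLabels) : ∀ s : D.State, Φ.Sat D s := by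
  induction hΦ with
  | top a => exact StateFormula.sat_top a D
  | eventually hc q a hlit hsat =>
    intro s
    rcases hsat.trivial_or_exists_sat (hB _ hc) with h | ⟨D', p', hp'⟩
    · exact h D s
    · refine hsat.sat_prob (hB _ hc) fun p _ hp => ?_
      rw [PathFormula.Sat] at hp' ⊢
      -- A literal formula sees only the label, so the label that makes it true in the foreign chain
      -- can be looked for on `p`.
      obtain ⟨j, hj, _⟩ := hp'
      obtain ⟨i, hi⟩ := hD p hp (D'.label (p' j))
      exact ⟨i, (hlit.sat_iff_of_label_eq hi).2 hj, fun k _ => StateFormula.sat_top a D _⟩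
  | and _ _ ih₁ ih₂ =>
    intro s
    rw [StateFormula.Sat]
    exact ⟨ih₁ s, ih₂ s⟩
  | or_left _ _ ih =>
    intro s
    rw [StateFormula.Sat]
    exact .inl (ih s)
  | or_right _ _ ih =>
    intro s
    rw [StateFormula.Sat]
    exact .inr (ih s)
  | weakUntil_left hc q _ _ hsat ih =>
    refine fun s => hsat.sat_prob (hB _ hc) fun p _ _ => ?_
    rw [PathFormula.Sat]
    exact .inr fun i => ih (p i)
  | weakUntil_right hc q _ _ hsat ih =>
    refine fun s => hsat.sat_prob (hB _ hc) fun p _ _ => ?_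
    rw [PathFormula.Sat]
    exact .inl ⟨0, ih (p 0), fun k hk => absurd hk (Nat.not_lt_zero k)⟩
  | next hc q _ hsat ih =>
    refine fun s => hsat.sat_prob (hB _ hc) fun p _ _ => ?_
    rw [PathFormula.Sat]
    exact ih (p 1)
  -- The remaining case is `until`.
  | _ hc q _ _ hsat ih =>
    refine fun s => hsat.sat_prob (hB _ hc) fun p _ _ => ?_
    rw [PathFormula.Sat]
    exact ⟨0, ih (p 0), fun k hk => absurd hk (Nat.not_lt_zero k)⟩

-- A total tree as the unfolding of the chain on its nodes.

namespace ProbTree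

theorem ne_nil {ι : Type*} (T : ProbTree ι AP) (π : T.nodes) : π.1 ≠ [] :=
  fun h => T.nil_notMem (h ▸ π.2)

/-- A distribution has nonempty support, so by `edge_pos` a defined edge forces a child. -/
theorem exists_concat_mem_iff {ι : Type*} (T : ProbTree ι AP) (π : T.nodes) :
    (∃ i, π.1 ++ [i] ∈ T.nodes) ↔ T.edge π ≠ none := by
  constructor
  · rintro ⟨i, hi⟩
    obtain ⟨μ, hμ, _⟩ := (T.edge_pos π ⟨_, hi⟩).2 ⟨i, rfl⟩
    simp [hμ]
  · intro h
    obtain ⟨μ, hμ⟩ := Option.ne_none_iff_exists'.1 h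
    obtain ⟨π', hπ'⟩ := μ.support_nonempty
    obtain ⟨i, hi⟩ := (T.edge_pos π π').1 ⟨μ, hμ, (PMF.apply_pos_iff _ _).2 hπ'⟩
    exact ⟨i, hi ▸ π'.2⟩

theorem IsTotal.edge_isSome {ι : Type*} {T : ProbTree ι AP} (hT : T.IsTotal) (π : T.nodes) :
    (T.edge π).isSome := by
  rw [Option.isSome_iff_ne_none, ← T.exists_concat_mem_iff]
  obtain ⟨π', h', ⟨l, rfl⟩, hne⟩ := hT π.1 π.2
  cases l with
  | nil => simp at hne
  | cons i l => exact ⟨i, T.prefix_closed _ h' _ ⟨l, by simp⟩ (by simp)⟩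

/-- The Markov chain whose states are the nodes of a total tree. -/
noncomputable def toMarkovChain (T : ProbTree ℕ AP) (hT : T.IsTotal) : MarkovChain AP where
  State := T.nodes
  countable_state := inferInstance
  trans π := (T.edge π).get (hT.edge_isSome π)
  label := T.label
  init := ⟨[T.exists_unique_root.choose], T.exists_unique_root.choose_spec.1⟩

variable {T : ProbTree ℕ AP} (hT : T.IsTotal)

theorem prob_eq_trans (π π' : T.nodes) :
    T.prob π π' = (T.toMarkovChain hT).trans π π' := by
  obtain ⟨μ, hμ⟩ := Option.isSome_iff_exists.1 (hT.edge_isSome π)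
  simp only [prob, toMarkovChain, hμ, Option.elim_some, Option.get_some]
  rfl

theorem mem_support_trans_iff (π π' : T.nodes) :
    π' ∈ ((T.toMarkovChain hT).trans π).support ↔ ∃ i, π'.1 = π.1 ++ [i] := by
  obtain ⟨μ, hμ⟩ := Option.isSome_iff_exists.1 (hT.edge_isSome π)
  have h : (T.toMarkovChain hT).trans π = μ := by simp only [toMarkovChain, hμ, Option.get_some]
  rw [← T.edge_pos, h]
  simp only [hμ, Option.some.injEq, exists_eq_left']
  exact (PMF.apply_pos_iff μ π').symm

/-- In a tree the predecessor of a node is found by dropping the last letter, and the root, of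
length one, succeeds no node. So a history can be read backwards from its last state. -/
theorem history_unique {l l' : List (T.toMarkovChain hT).State} {π : T.nodes}
    (h : (T.toMarkovChain hT).History l π) (h' : (T.toMarkovChain hT).History l' π) : l = l' := by
  have root_ne : ∀ π₀ : T.nodes,
      (T.toMarkovChain hT).init ∉ ((T.toMarkovChain hT).trans π₀).support := by
    intro π₀ hmem
    obtain ⟨i, hi⟩ := (mem_support_trans_iff hT _ _).1 hmem
    have := congrArg List.length hi
    have h2 := List.length_pos_iff.2 (T.ne_nil π₀)
    simp [toMarkovChain] at this
    exact T.ne_nil π₀ this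
  induction h generalizing l' with
  | init =>
    generalize hs : (T.toMarkovChain hT).init = s at h'
    cases h' with
    | init => rfl
    | step _ ht => exact absurd (hs ▸ ht) (root_ne _)
  | @step l₀ s t _ ht ih =>
    cases h' with
    | init => exact absurd ht (root_ne _)
    | @step l₁ s' _ h₁ ht' =>
      obtain ⟨i, hi⟩ := (mem_support_trans_iff hT _ _).1 ht
      obtain ⟨j, hj⟩ := (mem_support_trans_iff hT _ _).1 ht'
      obtain rfl : s = s' := Subtype.ext (List.append_inj_left' (hi.symm.trans hj) rfl)
      rw [ih h₁]

theorem exists_history (π : T.nodes) : ∃ l, (T.toMarkovChain hT).History l π := by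
  obtain ⟨l, hl⟩ := π
  induction l using List.reverseRecOn with
  | nil => exact absurd hl T.nil_notMem
  | append_singleton l i ih =>
    by_cases h : l = []
    · subst h
      have : (⟨[i], hl⟩ : T.nodes) = (T.toMarkovChain hT).init :=
        Subtype.ext (congrArg (fun j => [j]) (T.exists_unique_root.choose_spec.2 i hl))
      exact ⟨_, this ▸ MarkovChain.History.init⟩
    · have hl' : l ∈ T.nodes := T.prefix_closed _ hl _ ⟨[i], rfl⟩ h
      obtain ⟨l', h'⟩ := ih hl'
      exact ⟨_, h'.step ((mem_support_trans_iff hT ⟨l, hl'⟩ ⟨_, hl⟩).2 ⟨i, rfl⟩)⟩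

theorem _root_.PCTL.MarkovChain.unfolding_prob_concat (D : MarkovChain AP)
    (π π' : D.unfolding.nodes) :
    (π'.1 = π.1 ++ [D.lastState π'] →
      D.unfolding.prob π π' = D.trans (D.lastState π) (D.lastState π')) ∧
    (π'.1 ≠ π.1 ++ [D.lastState π'] → D.unfolding.prob π π' = 0) := by
  have hp : D.unfolding.prob π π' = ((D.trans (D.lastState π)).bindOnSupport fun t ht =>
    PMF.pure (⟨π.1 ++ [t], t, (D.history_lastState π).step ht⟩ : D.unfolding.nodes)) π' := rfl
  have hlast : ∀ t, π'.1 = π.1 ++ [t] → t = D.lastState π' := by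
    intro t ht
    have h1 := (D.history_lastState π').getLast?_eq
    rw [ht] at h1
    simpa using h1
  constructor
  · intro h
    rw [hp, PMF.bindOnSupport_apply, tsum_eq_single (D.lastState π')]
    · split_ifs with h0
      · simp [h0]
      · rw [PMF.pure_apply, if_pos (Subtype.ext h), mul_one]
    · intro t ht
      split_ifs with h0
      · simp
      · rw [PMF.pure_apply, if_neg, mul_zero]
        exact fun he => ht (hlast t (congrArg Subtype.val he))
  · intro h
    by_contra h0
    rw [hp] at h0
    obtain ⟨t, ht, h1⟩ := (PMF.mem_support_bindOnSupport_iff _ _).1 ((PMF.mem_support_iff _ _).2 h0)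
    have h2 := congrArg Subtype.val ((PMF.mem_support_pure_iff _ _).1 h1)
    exact h (hlast t h2 ▸ h2)

/-- A total tree is, up to renaming of nodes, the unfolding of the chain on its nodes. -/
theorem unfolding_toMarkovChain_iso : (T.toMarkovChain hT).unfolding.Iso T := by
  -- A node of the unfolding is a sequence of nodes of `T`; the renaming keeps only its last entry.
  have hbij : Function.Bijective
      (fun π : (T.toMarkovChain hT).unfolding.nodes => (T.toMarkovChain hT).lastState π) := by
    constructor
    · intro π π' h
      have h1 := (T.toMarkovChain hT).history_lastState π
      have h2 := (T.toMarkovChain hT).history_lastState π'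
      have h : (T.toMarkovChain hT).lastState π = (T.toMarkovChain hT).lastState π' := h
      rw [← h] at h2
      exact Subtype.ext (history_unique hT h1 h2)
    · intro π
      obtain ⟨l, hl⟩ := exists_history hT π
      refine ⟨⟨l, _, hl⟩, ?_⟩
      have h1 := ((T.toMarkovChain hT).history_lastState ⟨l, _, hl⟩).getLast?_eq
      exact Option.some.inj (h1.symm.trans hl.getLast?_eq)
  refine ⟨Equiv.ofBijective _ hbij, fun _ => rfl, fun π π' => ?_⟩
  refine (prob_eq_trans hT ((T.toMarkovChain hT).lastState π)
    ((T.toMarkovChain hT).lastState π')).trans ?_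
  by_cases h : π'.1 = π.1 ++ [(T.toMarkovChain hT).lastState π']
  · exact (((T.toMarkovChain hT).unfolding_prob_concat π π').1 h).symm
  · rw [((T.toMarkovChain hT).unfolding_prob_concat π π').2 h, PMF.apply_eq_zero_iff]
    intro hmem
    exact h (history_unique hT ((T.toMarkovChain hT).history_lastState π')
      (((T.toMarkovChain hT).history_lastState π).step hmem))

-- Prolonging a finite-depth tree below its leaves.

variable (T) in
/-- The nodes of `T` together with one infinite branch below each leaf. -/
def prolongedNodes : Set (List ℕ) :=
  T.nodes ∪ {π | ∃ l : T.nodes, T.edge l = none ∧ ∃ k, π = l.1 ++ List.replicate (k + 1) 0}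

/-- Inner nodes gain no children: the parent of a new node is a leaf `l` or again lies strictly
below `l`, and in the second case it cannot be in `T`, since prefix closure would give `l` a child.
-/
theorem concat_mem_of_edge_ne_none {π : T.nodes} (hπ : T.edge π ≠ none) {i : ℕ}
    (h : π.1 ++ [i] ∈ T.prolongedNodes) : π.1 ++ [i] ∈ T.nodes := by
  rcases h with h | ⟨l, hl, k, hk⟩
  · exact h
  · rw [List.replicate_succ', ← List.append_assoc] at hk
    have hk := List.append_inj_left' hk rfl
    cases k with
    | zero =>
      obtain rfl : π = l := Subtype.ext (by simpa using hk)
      exact absurd hl hπ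
    | succ k =>
      refine absurd hl ((T.exists_concat_mem_iff l).1
        ⟨0, T.prefix_closed _ π.2 _ ⟨List.replicate k 0, ?_⟩ (by simp)⟩)
      simp [hk, List.replicate_succ]

theorem eq_zero_of_concat_mem {π : List ℕ} {i : ℕ} (h : π ++ [i] ∈ T.prolongedNodes)
    (hn : π ++ [i] ∉ T.nodes) : i = 0 := by
  rcases h with h | ⟨l, hl, k, hk⟩
  · exact absurd h hn
  · rw [List.replicate_succ', ← List.append_assoc] at hk
    simpa using List.append_inj_right' hk rfl

/-- The condition `hn` covers both the leaves of `T` and, vacuously, the nodes outside `T`. -/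
theorem concat_zero_mem {π : List ℕ} (h : π ∈ T.prolongedNodes)
    (hn : ∀ hπ : π ∈ T.nodes, T.edge ⟨π, hπ⟩ = none) : π ++ [0] ∈ T.prolongedNodes := by
  rcases h with h | ⟨l, hl, k, rfl⟩
  · exact .inr ⟨⟨π, h⟩, hn h, 0, rfl⟩
  · refine .inr ⟨l, hl, k + 1, ?_⟩
    rw [List.replicate_succ' (n := k + 1), List.append_assoc]

open Classical in
variable (T) in
/-- The tree `T` prolonged by one infinite branch below each leaf, where a new node `π` is labelled
by `f π.length`. -/
noncomputable def prolong (f : ℕ → Set AP) : ProbTree ℕ AP where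
  nodes := T.prolongedNodes
  nil_notMem := by
    rintro (h | ⟨l, _, k, hk⟩)
    · exact T.nil_notMem h
    · simp at hk
  prefix_closed := by
    have aux : ∀ (l : T.nodes), T.edge l = none → ∀ (k : ℕ) (π' : List ℕ),
        π' <+: l.1 ++ List.replicate k 0 → π' ≠ [] → π' ∈ T.prolongedNodes := by
      intro l hl k
      induction k with
      | zero =>
        intro π' h1 h2
        exact .inl (T.prefix_closed _ l.2 _ (by simpa using h1) h2)
      | succ k ih =>
        intro π' h1 h2
        have h3 := h1
        rw [List.replicate_succ', ← List.append_assoc, List.prefix_concat_iff] at h3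
        rcases h3 with h3 | h3
        · exact .inr ⟨l, hl, k, by rw [h3, List.replicate_succ', List.append_assoc]⟩
        · exact ih π' h3 h2
    rintro π (h | ⟨l, hl, k, rfl⟩) π' h1 h2
    · exact .inl (T.prefix_closed _ h _ h1 h2)
    · exact aux l hl _ π' h1 h2
  exists_unique_root := by
    obtain ⟨i, hi, hu⟩ := T.exists_unique_root
    refine ⟨i, .inl hi, ?_⟩
    rintro j (h | ⟨l, _, k, hk⟩)
    · exact hu j h
    · have := congrArg List.length hk
      have h2 := List.length_pos_iff.2 (T.ne_nil l)
      simp at this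
      omega
  label π := if h : π.1 ∈ T.nodes then T.label ⟨π.1, h⟩ else f π.1.length
  edge π :=
    if h : ∃ hπ : π.1 ∈ T.nodes, T.edge ⟨π.1, hπ⟩ ≠ none then
      (T.edge ⟨π.1, h.1⟩).map fun μ => μ.map (Set.inclusion Set.subset_union_left)
    else some (PMF.pure ⟨π.1 ++ [0], concat_zero_mem π.2 fun hπ => by
      by_contra h'
      exact h ⟨hπ, h'⟩⟩)
  edge_pos π π' := by
    split_ifs with h
    · obtain ⟨hπ, he⟩ := h
      obtain ⟨μ, hμ⟩ := Option.ne_none_iff_exists'.1 he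
      simp only [hμ, Option.map_some, Option.some.injEq, exists_eq_left', PMF.apply_pos_iff,
        PMF.mem_support_map_iff]
      constructor
      · rintro ⟨ρ, hρ, rfl⟩
        exact (T.edge_pos ⟨π.1, hπ⟩ ρ).1 ⟨μ, hμ, (PMF.apply_pos_iff _ _).2 hρ⟩
      · rintro ⟨i, hi⟩
        have h1 : π'.1 ∈ T.nodes :=
          hi ▸ concat_mem_of_edge_ne_none (π := ⟨π.1, hπ⟩) he (hi ▸ π'.2)
        obtain ⟨ν, hν, hpos⟩ := (T.edge_pos ⟨π.1, hπ⟩ ⟨π'.1, h1⟩).2 ⟨i, hi⟩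
        rw [hμ] at hν
        obtain rfl := Option.some.inj hν
        exact ⟨_, (PMF.apply_pos_iff _ _).1 hpos, rfl⟩
    · simp only [Option.some.injEq, exists_eq_left', PMF.apply_pos_iff, PMF.mem_support_pure_iff]
      constructor
      · rintro rfl
        exact ⟨0, rfl⟩
      · rintro ⟨i, hi⟩
        have hn : π.1 ++ [i] ∉ T.nodes := by
          intro hmem
          have hπ : π.1 ∈ T.nodes :=
            T.prefix_closed _ hmem _ ⟨[i], rfl⟩ fun h0 => by
              rcases π.2 with h1 | ⟨l, _, k, hk⟩
              · exact T.nil_notMem (h0 ▸ h1)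
              · simp [h0] at hk
          exact h ⟨hπ, (T.exists_concat_mem_iff ⟨π.1, hπ⟩).1 ⟨i, hmem⟩⟩
        obtain rfl := eq_zero_of_concat_mem (hi ▸ π'.2) hn
        exact Subtype.ext hi

theorem isTotal_prolong (f : ℕ → Set AP) : (T.prolong f).IsTotal := by
  intro π hπ
  have h : (T.prolong f).edge ⟨π, hπ⟩ ≠ none := by
    simp only [prolong]
    split_ifs with h
    · simpa using h.2
    · simp
  obtain ⟨i, hi⟩ := ((T.prolong f).exists_concat_mem_iff ⟨π, hπ⟩).2 h
  exact ⟨_, hi, ⟨[i], rfl⟩, by simp⟩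

theorem isPrefix_prolong (f : ℕ → Set AP) : T.IsPrefix (T.prolong f) := by
  refine ⟨Set.subset_union_left, fun π => ?_, fun π π' => ?_⟩
  · simp [prolong]
  · by_cases h : T.edge π = none
    -- At a leaf the new distribution is concentrated on a node outside `T`, so between nodes of `T`
    -- the probability stays 0.
    · have h1 : π'.1 ≠ π.1 ++ [0] := fun h2 =>
        (T.exists_concat_mem_iff π).1 ⟨0, h2 ▸ π'.2⟩ h
      have he : (T.prolong f).edge (Set.inclusion Set.subset_union_left π) = _ :=
        dif_neg fun h2 => h2.2 h
      rw [prob, prob, he, h]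
      exact (PMF.apply_eq_zero_iff _ _).2 fun hmem =>
        h1 (congrArg Subtype.val ((PMF.mem_support_pure_iff _ _).1 hmem))
    · obtain ⟨μ, hμ⟩ := Option.ne_none_iff_exists'.1 h
      have he : (T.prolong f).edge (Set.inclusion Set.subset_union_left π) =
          (T.edge π).map fun μ => μ.map (Set.inclusion Set.subset_union_left) :=
        dif_pos ⟨π.2, h⟩
      rw [prob, prob, he, hμ]
      refine (PMF.map_apply _ _ _).trans ((tsum_eq_single π' fun ρ hρ => if_neg fun h2 => ?_).trans
        (if_pos rfl))
      exact hρ (Set.inclusion_injective _ h2).symm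

theorem label_prolong_of_notMem {f : ℕ → Set AP} {π : (T.prolong f).nodes} (h : π.1 ∉ T.nodes) :
    (T.prolong f).label π = f π.1.length :=
  dif_neg h

theorem visitsAllLabels_prolong (hfin : T.IsFiniteDepth) {f : ℕ → Set AP}
    (hf : ∀ A n, ∃ m ≥ n, f m = A) :
    ((T.prolong f).toMarkovChain (isTotal_prolong f)).VisitsAllLabels := by
  intro (p : ℕ → (T.prolong f).nodes) hp A
  obtain ⟨N, hN⟩ := hfin
  have hlen : ∀ n, (p n).1.length = (p 0).1.length + n := by
    intro n
    induction n with
    | zero => rfl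
    | succ n ih =>
      obtain ⟨i, hi⟩ := (mem_support_trans_iff (isTotal_prolong f) _ _).1 (hp n)
      rw [hi, List.length_append, ih]
      rfl
  -- Each step adds one letter, so `p` passes through length `m`; as `m > N`, the node reached there
  -- is new and carries the label `f m`.
  obtain ⟨m, hm, rfl⟩ := hf A ((p 0).1.length + N + 1)
  refine ⟨m - (p 0).1.length, ?_⟩
  have h1 : (p (m - (p 0).1.length)).1.length = m := by
    rw [hlen]
    omega
  refine (label_prolong_of_notMem fun hmem => ?_).trans (congrArg f h1)
  have := hN _ hmem
  omega

end ProbTree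

-- The recurrent labelling and the conclusion.

theorem exists_forall_frequently_eq (α : Type*) [Finite α] [Nonempty α] :
    ∃ f : ℕ → α, ∀ a n, ∃ m ≥ n, f m = a := by
  obtain ⟨g, hg⟩ := exists_surjective_nat α
  -- The first component of `Nat.unpair` takes each value `k` at all the arguments `Nat.pair k n ≥
  -- n`.
  refine ⟨fun n => g n.unpair.1, fun a n => ?_⟩
  obtain ⟨k, rfl⟩ := hg a
  exact ⟨Nat.pair k n, Nat.right_le_pair k n, by simp⟩

theorem LiveFragment.isLiveness_property [Finite AP] {B : Set Cmp}
    (hB : ∀ c ∈ B, c = .ge ∨ c = .gt) {Φ : StateFormula AP} (hΦ : LiveFragment B Φ) :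
    IsLiveness (property Φ) := by
  refine ⟨fun T hT => hT.1, fun T hT => ?_⟩
  obtain ⟨f, hf⟩ := exists_forall_frequently_eq (Set AP)
  exact ⟨T.prolong f, ⟨ProbTree.isTotal_prolong f, _,
    hΦ.sat_of_visitsAllLabels hB (ProbTree.visitsAllLabels_prolong hT hf) _,
    ProbTree.unfolding_toMarkovChain_iso _⟩, ProbTree.isPrefix_prolong f⟩

end PCTL

theorem mainTheorem7 {AP : Type*} [Finite AP] [Nonempty AP] :
    (∀ Φ : PCTL.StateFormula AP, PCTL.LiveFragment {.ge} Φ →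
      PCTL.IsLiveness (PCTL.property Φ)) ∧
    (∀ Φ : PCTL.StateFormula AP, PCTL.LiveFragment {.ge, .gt} Φ →
      PCTL.IsLiveness (PCTL.property Φ)) :=
  ⟨fun _ h => h.isLiveness_property fun _ hc => .inl hc,
    fun _ h => h.isLiveness_property fun _ hc => hc⟩
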